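/- Let $X$ be a real or complex Banach space. A continuous function $f$ from $\mathbb{R}$ to a Banach space $Y$ is called recurrent if for every compact $K\subset\mathbb{R}$ and every $\varepsilon>0$ the set $\{\tau\in\mathbb{R} : \|f(t+\tau)-f(t)\|\le\varepsilon \text{ for all } t\in K\}$ is relatively dense, where $E\subset\mathbb{R}$ is relatively dense if $E+L=\mathbb{R}$ for some compact $L\subset\mathbb{R}$. Let $REC(\mathbb{R},Y)$ be the set of all recurrent functions, let $REC_u(\mathbb{R},X)$ be the set of all uniformly continuous $f\in REC(\mathbb{R},X)$, and let $REC_{urc}(\mathbb{R},X)$ be the set of those $f\in REC_u(\mathbb{R},X)$ whose range is relatively compact in $X$. Consider for sets $U$ of functions $\mathbb{R}\to X$ the condition $$(3.2)\qquad n\in\{1,2,\dots\},\ f_1,\dots,f_n\in U \ \text{ imply }\ (f_1,\dots,f_n)\in REC(\mathbb{R},X^n).$$ For $xy\in\{u,urc\}$ and $\emptyset\ne V\subset REC_{xy}(\mathbb{R},X)$ satisfying (3.2), let $rec_{xy}V$ denote any maximal element (with respect to inclusion) of the family of all $U$ with $V\subset U\subset REC_{xy}(\mathbb{R},X)$ that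 satisfy (3.2). Let $\mathcal{E}$ be the set of ergodic functions, that is, of all $f\in L^1_{loc}(\mathbb{R},X)$ for which there is an $m\in X$ with $$\lim_{T\to\infty}\ \sup_{x\in\mathbb{R}}\Big\|\frac1{2T}\int_{-T}^{T}f(t+x)\,dt-m\Big\|=0.$$ Here the elements of $L^1_{loc}(\mathbb{R},X)$ are everywhere defined functions (not equivalence classes), and integrals are Bochner integrals. **Proposition 4.2.** Let $xy\in\{u,urc\}$. If $\emptyset\ne V\subset REC_{xy}(\mathbb{R},X)$ satisfies (3.2), then both $\mathcal{A}=rec_{xy}V$ and $\mathcal{A}=REC_{xy}(\mathbb{R},X)$ have the following two properties: * $(L_{\mathcal{E}})$: if $F\in\mathcal{E}$ and for every $h>0$ the difference $\Delta_hF=F(\cdot+h)-F$ belongs to $\mathcal{A}$, then $F\in\mathcal{A}$; * $(P_{\mathcal{E}})$: if $f\in\mathcal{A}$ and its indefinite integral $Pf(t)=\int_0^t f(s)\,ds$ belongs to $\mathcal{E}$, then $Pf\in\mathcal{A}$. -/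

import Mathlib

open Set Filter Topology MeasureTheory
open scoped Pointwise

/-- A subset `E` of a topological abelian group is relatively dense if `E + L` is the
whole group for some compact `L`. -/
def RelativelyDense {G : Type*} [AddCommGroup G] [TopologicalSpace G] (E : Set G) : Prop :=
  ∃ L : Set G, IsCompact L ∧ E + L = univ

/-- The set `E(f, ε, K)` of `ε`-`K`-periods of `f`. -/
def periodSet {G Y : Type*} [AddCommGroup G] [NormedAddCommGroup Y]
    (f : G → Y) (ε : ℝ) (K : Set G) : Set G :=
  {τ | ∀ t ∈ K, ‖f (t + τ) - f t‖ ≤ ε}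

/-- Recurrent functions on a topological abelian group. -/
def IsRecurrent {G Y : Type*} [AddCommGroup G] [TopologicalSpace G] [NormedAddCommGroup Y]
    (f : G → Y) : Prop :=
  Continuous f ∧ ∀ K : Set G, IsCompact K → ∀ ε : ℝ, 0 < ε → RelativelyDense (periodSet f ε K)

/-- `REC_u(ℝ, X)`: the uniformly continuous recurrent functions `ℝ → X`. -/
def RECu (X : Type*) [NormedAddCommGroup X] : Set (ℝ → X) :=
  {f | IsRecurrent f ∧ UniformContinuous f}

/-- `REC_urc(ℝ, X)`: the uniformly continuous recurrent functions `ℝ → X` with relatively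
compact range. -/
def RECurc (X : Type*) [NormedAddCommGroup X] : Set (ℝ → X) :=
  {f | IsRecurrent f ∧ UniformContinuous f ∧ IsCompact (closure (range f))}

/-- Joint recurrence of a set `U` of functions: for all `n ≥ 1` and `f₁, …, fₙ ∈ U` the function
`(f₁, …, fₙ) : ℝ → Xⁿ` is recurrent. (`Fin n → X` carries the maximum norm; all the usual product
norms are equivalent, and so give the same recurrent functions.) -/
def JointlyRecurrent {X : Type*} [NormedAddCommGroup X] (U : Set (ℝ → X)) : Prop :=
  ∀ n : ℕ, 1 ≤ n → ∀ f : Fin n → ℝ → X, (∀ i, f i ∈ U) →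
    IsRecurrent (fun t : ℝ => fun i : Fin n => f i t)

/-- `A` is a possible choice of `rec_xy V`, where `R = REC_xy(ℝ, X)`: a maximal element, for
inclusion, of the family of all jointly recurrent `U` with `V ⊆ U ⊆ R`. -/
def IsRec {X : Type*} [NormedAddCommGroup X] (R V A : Set (ℝ → X)) : Prop :=
  Maximal (fun U : Set (ℝ → X) => U ⊆ R ∧ V ⊆ U ∧ JointlyRecurrent U) A

/-- Sets `rec_xy V` exist. -/
theorem exists_isRec {X : Type*} [NormedAddCommGroup X] {R V : Set (ℝ → X)}
    (hVR : V ⊆ R) (hV : JointlyRecurrent V) : ∃ A, IsRec R V A := by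
  have key : ∀ c ⊆ {U : Set (ℝ → X) | U ⊆ R ∧ V ⊆ U ∧ JointlyRecurrent U},
      IsChain (· ⊆ ·) c → c.Nonempty →
      ∃ ub ∈ {U : Set (ℝ → X) | U ⊆ R ∧ V ⊆ U ∧ JointlyRecurrent U}, ∀ s ∈ c, s ⊆ ub := by
    rintro c hc hchain ⟨U₀, hU₀⟩
    refine ⟨⋃₀ c, ⟨sUnion_subset fun U hU => (hc hU).1,
      (hc hU₀).2.1.trans (subset_sUnion_of_mem hU₀), ?_⟩, fun U hU => subset_sUnion_of_mem hU⟩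
    intro n hn f hf
    obtain ⟨U, hU, hfU⟩ := DirectedOn.exists_mem_subset_of_finite_of_subset_sUnion
      ⟨U₀, hU₀⟩ hchain.directedOn (finite_range f) (range_subset_iff.2 hf)
    exact (hc hU).2.2 n hn f fun i => hfU (mem_range_self i)
  obtain ⟨A, -, hA⟩ := zorn_subset_nonempty _ key V ⟨hVR, Subset.rfl, hV⟩
  exact ⟨A, hA⟩

/-- The ergodic functions `ℝ → X`: locally (Bochner) integrable `f` such that, for some `m`, the
means `(1 / 2T) ∫_{-T}^{T} f (t + x) dt` tend to `m` as `T → ∞`, uniformly in `x`. -/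
def ergodicFunctions (X : Type*) [NormedAddCommGroup X] [NormedSpace ℝ X] : Set (ℝ → X) :=
  {f | LocallyIntegrable f ∧ ∃ m : X,
    TendstoUniformly (fun (T x : ℝ) => (1 / (2 * T)) • ∫ t in (-T)..T, f (t + x))
      (fun _ : ℝ => m) atTop}

/-- `A` satisfies `(L_U)`: if `F ∈ U` and all differences `Δ_h F = F (· + h) - F`,
`h > 0`, belong to `A`, then `F ∈ A`. -/
def SatisfiesL {X : Type*} [NormedAddCommGroup X] (A U : Set (ℝ → X)) : Prop :=
  ∀ F ∈ U, (∀ h : ℝ, 0 < h → fwdDiff h F ∈ A) → F ∈ A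

/-- The indefinite integral `Pf`. -/
noncomputable def indefIntegral {X : Type*} [NormedAddCommGroup X] [NormedSpace ℝ X]
    (f : ℝ → X) : ℝ → X :=
  fun t => ∫ s in (0 : ℝ)..t, f s

/-- `A` satisfies `(P_U)`: if `f ∈ A` and `Pf ∈ U`, then `Pf ∈ A`. -/
def SatisfiesP {X : Type*} [NormedAddCommGroup X] [NormedSpace ℝ X] (A U : Set (ℝ → X)) : Prop :=
  ∀ f ∈ A, indefIntegral f ∈ U → indefIntegral f ∈ A

/-!
Write `M_S F x` for the mean of `F` over `[x, x + S]`. For an ergodic `F` with mean `m`, `M_S F`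
is uniformly close to `m` when `S` is large, and `M_S F x - F x` is the mean of `Δ_t F x` over
`t ∈ [0, S]`; so `F` is uniformly close to `m` minus a mean of its differences.

This is used twice. The differences are bounded, hence bounded locally uniformly in `t` by
Steinhaus' theorem (`exists_norm_fwdDiff_le`), and dominated convergence then shows that `F` is
uniformly continuous (`uniformContinuous_of_fwdDiff`). Now the mean may be replaced by a Riemann
sum with nodes `j d` (`exists_norm_sub_average_fwdDiff_le`). Since `Δ_{jd} F` is a sum of
translates of `Δ_d F`, all `ε'`-`K'`-periods of the single function `Δ_d F` are `ε`-`K`-periods of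
`F`, for suitable `K'` and `ε'` (`inheritsPeriods_of_fwdDiff`). The functions with this inheritance
property can be added to a jointly recurrent set without destroying joint recurrence
(`JointlyRecurrent.of_inheritsPeriods`), so they already belong to a maximal one
(`IsRec.mem_of_inheritsPeriods`). Relatively compact ranges are preserved by finite sums and
uniform limits. This gives `(L)`.

For `(P)`, `Δ_h Pf x` is the integral of `f` over `[x, x + h]`, which is uniformly continuous, has
relatively compact range if `f` has, and inherits its periods from `f`. So all `Δ_h Pf` lie in `A`,
and `(L)` applies to `Pf`.
-/

/-! ### Translations and boundedness -/

/-- A bound for small translations propagates to translations of any bounded size, by cutting a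
long translation into short ones. -/
theorem exists_translation_bound {X : Type*} [NormedAddCommGroup X] {F : ℝ → X} {η C : ℝ}
    (hη : 0 < η) (hF : ∀ h, |h| < η → ∀ x, ‖F (x + h) - F x‖ ≤ C) (r : ℝ) :
    ∃ C', ∀ h, |h| ≤ r → ∀ x, ‖F (x + h) - F x‖ ≤ C' := by
  obtain ⟨n, hn⟩ := exists_nat_gt (max (r / η) 0)
  have hn0 : (0 : ℝ) < n := lt_of_le_of_lt (le_max_right _ _) hn
  have hrn : r < n * η := (div_lt_iff₀ hη).1 (lt_of_le_of_lt (le_max_left _ _) hn)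
  refine ⟨n * C, fun h hh x => ?_⟩
  have hd : |h / n| < η := by
    rw [abs_div, abs_of_pos hn0, div_lt_iff₀ hn0]
    linarith
  have key : ∀ k : ℕ, ‖F (x + k * (h / n)) - F x‖ ≤ k * C := by
    intro k
    induction k with
    | zero => simp
    | succ k ih =>
      have h1 := norm_sub_le_norm_sub_add_norm_sub
        (F (x + k * (h / n) + h / n)) (F (x + k * (h / n))) (F x)
      have h2 := hF _ hd (x + k * (h / n))
      have h3 : x + ((k + 1 : ℕ) : ℝ) * (h / n) = x + k * (h / n) + h / n := by
        push_cast; ring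
      rw [h3]
      push_cast
      linarith
  have h4 := key n
  rwa [mul_div_cancel₀ h hn0.ne'] at h4

theorem UniformContinuous.exists_forall_norm_add_sub_le {X : Type*} [NormedAddCommGroup X]
    {f : ℝ → X} (hf : UniformContinuous f) {ε : ℝ} (hε : 0 < ε) :
    ∃ η > 0, ∀ h, |h| < η → ∀ x, ‖f (x + h) - f x‖ ≤ ε := by
  obtain ⟨η, hη, H⟩ := Metric.uniformContinuous_iff.1 hf ε hε
  refine ⟨η, hη, fun h hh x => ?_⟩
  rw [← dist_eq_norm]
  exact (H (by simpa [Real.dist_eq] using hh)).le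

/-- A uniformly continuous recurrent function is bounded: every point lies at bounded distance
from a period, where the function is almost equal to its value at `0`. -/
theorem exists_norm_le_of_mem_RECu {X : Type*} [NormedAddCommGroup X] {f : ℝ → X}
    (hf : f ∈ RECu X) : ∃ C, ∀ x, ‖f x‖ ≤ C := by
  obtain ⟨η, hη, hs⟩ := hf.2.exists_forall_norm_add_sub_le one_pos
  obtain ⟨L, hL, hLu⟩ := hf.1.2 {0} isCompact_singleton 1 one_pos
  obtain ⟨r, hr⟩ := hL.isBounded.exists_norm_le
  obtain ⟨C, hC⟩ := exists_translation_bound hη hs r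
  refine ⟨C + 1 + ‖f 0‖, fun x => ?_⟩
  obtain ⟨τ, hτ, l, hl, rfl⟩ : x ∈ periodSet f 1 {0} + L := hLu ▸ mem_univ x
  have h1 := hC l (hr l hl) τ
  have h2 := hτ 0 rfl
  rw [zero_add] at h2
  have h3 := norm_sub_norm_le (f (τ + l)) (f τ)
  have h4 := norm_sub_norm_le (f τ) (f 0)
  simp only
  linarith

theorem RECurc_subset_RECu (X : Type*) [NormedAddCommGroup X] : RECurc X ⊆ RECu X :=
  fun _ hf => ⟨hf.1, hf.2.1⟩

/-! ### Uniform continuity of ergodic functions from that of their differences -/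

/-- If all differences `Δ_h F`, `h > 0`, of a locally integrable function are bounded, then
`‖Δ_h F‖_∞` is bounded for `h` in bounded sets. The values of `h > 0` with `‖Δ_h F‖_∞ ≤ n` form
a set `E n`; some `E n` has positive measure, so that `E n - E n` is a neighbourhood of `0` by
Steinhaus' theorem. Continuity of the differences makes `E n` measurable. -/
theorem exists_norm_fwdDiff_le {X : Type*} [NormedAddCommGroup X] {F : ℝ → X}
    (hF : LocallyIntegrable F) (hc : ∀ h : ℝ, 0 < h → Continuous (fwdDiff h F))
    (hb : ∀ h : ℝ, 0 < h → ∃ C, ∀ x, ‖fwdDiff h F x‖ ≤ C) (r : ℝ) :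
    ∃ C, ∀ h, |h| ≤ r → ∀ x, ‖F (x + h) - F x‖ ≤ C := by
  have hm : AEStronglyMeasurable F volume := hF.aestronglyMeasurable
  let E : ℕ → Set ℝ := fun n => {h | 0 < h ∧ ∀ q : ℚ, ‖F (q + h) - F q‖ ≤ n}
  have hEm : ∀ n, NullMeasurableSet (E n) volume := by
    intro n
    have : E n = Ioi 0 ∩ ⋂ q : ℚ, {h | ‖F (q + h) - F q‖ ≤ n} := by
      ext h; simp [E]
    rw [this]
    refine measurableSet_Ioi.nullMeasurableSet.inter (NullMeasurableSet.iInter fun q => ?_)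
    have h1 : AEStronglyMeasurable (fun h => F ((q : ℝ) + h)) volume :=
      hm.comp_measurePreserving (measurePreserving_add_left volume (q : ℝ))
    exact nullMeasurableSet_le (h1.sub aestronglyMeasurable_const).norm.aemeasurable
      aemeasurable_const
  have hEb : ∀ n, ∀ h ∈ E n, ∀ x, ‖F (x + h) - F x‖ ≤ n := by
    intro n h hh x
    have hcl : IsClosed {x | ‖fwdDiff h F x‖ ≤ n} :=
      isClosed_le (hc h hh.1).norm continuous_const
    have hd : Dense {x | ‖fwdDiff h F x‖ ≤ n} :=
      Rat.denseRange_cast.mono (by rintro _ ⟨q, rfl⟩; exact hh.2 q)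
    have : x ∈ {x | ‖fwdDiff h F x‖ ≤ n} := by
      rw [← hcl.closure_eq]; exact hd x
    exact this
  have hEu : Ioi (0 : ℝ) ⊆ ⋃ n, E n := by
    intro h hh
    obtain ⟨C, hC⟩ := hb h hh
    obtain ⟨n, hn⟩ := exists_nat_ge C
    exact mem_iUnion.2 ⟨n, hh, fun q => (hC q).trans hn⟩
  obtain ⟨n, hn⟩ : ∃ n, 0 < volume (E n) := by
    by_contra! H
    have h0 : volume (⋃ n, E n) = 0 :=
      measure_iUnion_null fun n => nonpos_iff_eq_zero.1 (H n)
    have h1 := measure_mono (μ := volume) hEu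
    simp [h0] at h1
  obtain ⟨E', hE'E, hE'm, hE'ae⟩ := (hEm n).exists_measurable_subset_ae_eq
  have hpos : 0 < volume E' := by rwa [measure_congr hE'ae]
  have hnhds := Measure.sub_mem_nhds_zero_of_addHaar_pos volume E' hE'm hpos
  obtain ⟨η, hη, hball⟩ := Metric.mem_nhds_iff.1 hnhds
  refine exists_translation_bound (C := n + n) hη (fun h hh x => ?_) r
  obtain ⟨a, ha, b, hb', rfl⟩ := hball (show h ∈ Metric.ball 0 η by simpa using hh)
  have h1 := hEb n a (hE'E ha) (x - b)
  have h2 := hEb n b (hE'E hb') (x - b)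
  rw [sub_add_cancel] at h2
  rw [show x - b + a = x + (a - b) by ring] at h1
  have h3 := norm_sub_le_norm_sub_add_norm_sub (F (x + (a - b))) (F (x - b)) (F x)
  rw [norm_sub_rev] at h2
  exact h3.trans (add_le_add h1 h2)

/-- The one-sided means of an ergodic function are uniformly close to the ergodic mean. -/
theorem exists_norm_average_sub_le {X : Type*} [NormedAddCommGroup X] [NormedSpace ℝ X]
    {F : ℝ → X} {m : X}
    (hm : TendstoUniformly (fun (T x : ℝ) => (1 / (2 * T)) • ∫ t in (-T)..T, F (t + x))
      (fun _ : ℝ => m) atTop) {ε : ℝ} (hε : 0 < ε) :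
    ∃ S > 0, ∀ x, ‖S⁻¹ • (∫ t in (0 : ℝ)..S, F (x + t)) - m‖ ≤ ε := by
  obtain ⟨T, hT, hT0⟩ := ((Metric.tendstoUniformly_iff.1 hm ε hε).and
    (eventually_gt_atTop 0)).exists
  refine ⟨2 * T, by positivity, fun x => ?_⟩
  have h1 := (hT (x + T)).le
  rw [dist_comm, dist_eq_norm] at h1
  have h2 : ∫ t in (0 : ℝ)..(2 * T), F (x + t) = ∫ t in (-T)..T, F (t + (x + T)) := by
    have := intervalIntegral.integral_comp_add_right (a := -T) (b := T)
      (fun t => F (x + t)) T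
    rw [show -T + T = 0 by ring, show T + T = 2 * T by ring] at this
    rw [← this]
    exact intervalIntegral.integral_congr fun t _ => congrArg F (by ring)
  rw [h2, ← one_div]
  exact h1

/-- An ergodic function with uniformly continuous recurrent differences is uniformly continuous.
By dominated convergence, the mean over `t ∈ [0, S]` of `Δ_t F a - Δ_t F b` is small when `a` and
`b` are close; it differs from `F b - F a` by a difference of two means of `F`, both of which are
close to the ergodic mean for large `S`. -/
theorem uniformContinuous_of_fwdDiff {X : Type*} [NormedAddCommGroup X] [NormedSpace ℝ X]
    [CompleteSpace X] {F : ℝ → X} (hF : F ∈ ergodicFunctions X)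
    (hd : ∀ h : ℝ, 0 < h → fwdDiff h F ∈ RECu X) :
    UniformContinuous F := by
  obtain ⟨hli, m, hm⟩ := hF
  have hint : ∀ x a b : ℝ, IntervalIntegrable (fun t => F (x + t)) volume a b := by
    intro x a b
    have h1 : IntervalIntegrable F volume (a + x) (b + x) :=
      (hli.integrableOn_isCompact isCompact_uIcc).intervalIntegrable
    simpa [add_comm x] using h1.comp_add_right x
  rw [Metric.uniformContinuous_iff_le]
  intro ε hε
  obtain ⟨S, hS, havg⟩ := exists_norm_average_sub_le hm (show 0 < ε / 4 by positivity)
  obtain ⟨C, hC⟩ := exists_norm_fwdDiff_le hli (fun h hh => (hd h hh).2.continuous)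
    (fun h hh => exists_norm_le_of_mem_RECu (hd h hh)) S
  -- The second differences tend to `0` pointwise in `t` and are bounded on `[0, S]`.
  have hlim : Tendsto (fun p : ℝ × ℝ => ∫ t in (0 : ℝ)..S,
      (F (p.1 + t) - F p.1 - (F (p.2 + t) - F p.2))) (uniformity ℝ)
      (𝓝 (∫ t in (0 : ℝ)..S, (0 : X))) := by
    refine intervalIntegral.tendsto_integral_filter_of_dominated_convergence (fun _ => C + C)
      (.of_forall fun p => ?_) (.of_forall fun p => .of_forall fun t ht => ?_) (by simp)
      (.of_forall fun t ht => ?_)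
    · exact ((((hint p.1 0 S).sub intervalIntegrable_const).sub
        ((hint p.2 0 S).sub intervalIntegrable_const))).def'.aestronglyMeasurable
    · rw [uIoc_of_le hS.le] at ht
      have hts : |t| ≤ S := by rw [abs_of_pos ht.1]; exact ht.2
      exact (norm_sub_le _ _).trans (add_le_add (hC t hts _) (hC t hts _))
    · rw [uIoc_of_le hS.le] at ht
      rw [tendsto_iff_dist_tendsto_zero]
      have h1 := tendsto_uniformity_iff_dist_tendsto_zero.1 (hd t ht.1).2
      simpa [dist_eq_norm, fwdDiff] using h1
  rw [intervalIntegral.integral_zero] at hlim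
  have hev := (Metric.tendsto_nhds.1 hlim) (S * (ε / 2)) (by positivity)
  obtain ⟨δ, hδ, H⟩ := Metric.mem_uniformity_dist.1 hev
  refine ⟨δ / 2, by positivity, fun {a b} hab => ?_⟩
  have h1 : dist _ _ < _ := H (show dist a b < δ by linarith)
  simp only [dist_zero_right] at h1
  have h2 : ∫ t in (0 : ℝ)..S, (F (a + t) - F a - (F (b + t) - F b)) =
      (∫ t in (0 : ℝ)..S, F (a + t)) - (∫ t in (0 : ℝ)..S, F (b + t)) - S • (F a - F b) := by
    rw [intervalIntegral.integral_sub ((hint a 0 S).sub intervalIntegrable_const)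
      ((hint b 0 S).sub intervalIntegrable_const), intervalIntegral.integral_sub (hint a 0 S)
      intervalIntegrable_const, intervalIntegral.integral_sub (hint b 0 S)
      intervalIntegrable_const]
    simp only [intervalIntegral.integral_const, sub_zero, smul_sub]
    abel
  have h3 : ‖S⁻¹ • ∫ t in (0 : ℝ)..S, (F (a + t) - F a - (F (b + t) - F b))‖ ≤ ε / 2 := by
    rw [norm_smul, norm_inv, Real.norm_of_nonneg hS.le, inv_mul_le_iff₀ hS]
    exact h1.le
  have h4 : F a - F b = (S⁻¹ • (∫ t in (0 : ℝ)..S, F (a + t)) - m) -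
      (S⁻¹ • (∫ t in (0 : ℝ)..S, F (b + t)) - m) -
      S⁻¹ • ∫ t in (0 : ℝ)..S, (F (a + t) - F a - (F (b + t) - F b)) := by
    rw [h2, smul_sub, smul_sub, inv_smul_smul₀ hS.ne']
    abel
  rw [dist_eq_norm, h4]
  have h5 := norm_sub_le (S⁻¹ • (∫ t in (0 : ℝ)..S, F (a + t)) - m)
    (S⁻¹ • (∫ t in (0 : ℝ)..S, F (b + t)) - m)
  refine (norm_sub_le _ _).trans ?_
  linarith [havg a, havg b]

/-! ### Riemann sums of translates -/

/-- The integrals `∫_x^{x+S} f` of a uniformly continuous `f` are approximated, uniformly in `x`,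
by Riemann sums with equidistant nodes. -/
theorem exists_norm_integral_sub_riemannSum_le {X : Type*} [NormedAddCommGroup X] [NormedSpace ℝ X]
    [CompleteSpace X] {f : ℝ → X} (hf : UniformContinuous f) {S ε : ℝ} (hS : 0 < S) (hε : 0 < ε) :
    ∃ N : ℕ, 0 < N ∧ ∀ x, ‖(∫ t in (0 : ℝ)..S, f (x + t)) -
      (S / N) • ∑ j ∈ Finset.range N, f (x + (j + 1) * (S / N))‖ ≤ ε := by
  obtain ⟨η, hη, H⟩ := hf.exists_forall_norm_add_sub_le (show 0 < ε / S by positivity)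
  obtain ⟨N, hN⟩ := exists_nat_gt (S / η)
  have hN0 : (0 : ℝ) < N := lt_trans (by positivity) hN
  refine ⟨N, by exact_mod_cast hN0, fun x => ?_⟩
  set d := S / N with hd
  have hd0 : 0 < d := by positivity
  have hdη : d < η := by rwa [hd, div_lt_comm₀ hN0 hη]
  have hint : ∀ a b : ℝ, IntervalIntegrable (fun t => f (x + t)) volume a b := fun a b =>
    (hf.continuous.comp (continuous_const.add continuous_id)).intervalIntegrable a b
  have h1 := intervalIntegral.sum_integral_adjacent_intervals (a := fun j : ℕ => (j : ℝ) * d)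
    (n := N) (μ := volume) (fun k _ => hint (k * d) ((k + 1 : ℕ) * d))
  have hNd : (N : ℝ) * d = S := by rw [hd]; field_simp
  rw [Nat.cast_zero, zero_mul, hNd] at h1
  rw [← h1, Finset.smul_sum, ← Finset.sum_sub_distrib]
  have h2 : ∀ j ∈ Finset.range N, ‖(∫ t in (j * d)..((j + 1 : ℕ) * d), f (x + t)) -
      d • f (x + (j + 1) * d)‖ ≤ ε / S * d := by
    intro j _
    have h3 : d • f (x + (j + 1) * d) =
        ∫ t in (j * d)..((j + 1 : ℕ) * d), f (x + (j + 1) * d) := by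
      rw [intervalIntegral.integral_const]; congr 1; push_cast; ring
    rw [h3, ← intervalIntegral.integral_sub (hint _ _) intervalIntegrable_const]
    have h4 : |((j + 1 : ℕ) : ℝ) * d - j * d| = d := by
      rw [show ((j + 1 : ℕ) : ℝ) * d - j * d = d by push_cast; ring, abs_of_pos hd0]
    have h5 := intervalIntegral.norm_integral_le_of_norm_le_const (C := ε / S)
      (f := fun t => f (x + t) - f (x + (j + 1) * d)) (a := j * d) (b := (j + 1 : ℕ) * d) ?_
    · rwa [h4] at h5
    · intro t ht
      rw [uIoc_of_le (by push_cast; nlinarith)] at ht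
      have h6 := H (t - (j + 1) * d) ?_ (x + (j + 1) * d)
      · rwa [show x + (j + 1) * d + (t - (j + 1) * d) = x + t by ring] at h6
      · have h7 := ht.1
        have h8 := ht.2
        push_cast at h8
        rw [abs_lt]
        constructor <;> linarith
  refine (norm_sum_le_of_le _ h2).trans ?_
  rw [Finset.sum_const, Finset.card_range, nsmul_eq_mul,
    show (N : ℝ) * (ε / S * d) = ε / S * (N * d) by ring, hNd, div_mul_cancel₀ _ hS.ne']

/-! ### Inheriting almost periods -/

/-- The function `G` inherits its almost periods from `A` if for every compact `K` and `ε > 0`,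
all `ε'`-`K'`-periods of a suitable single `f ∈ A` are `ε`-`K`-periods of `G`, for some compact
`K'` and `ε' > 0`. -/
def InheritsPeriods {X : Type*} [NormedAddCommGroup X] (A : Set (ℝ → X)) (G : ℝ → X) : Prop :=
  ∀ K : Set ℝ, IsCompact K → ∀ ε : ℝ, 0 < ε → ∃ f ∈ A, ∃ K' : Set ℝ, IsCompact K' ∧
    ∃ ε' : ℝ, 0 < ε' ∧ periodSet f ε' K' ⊆ periodSet G ε K

theorem RelativelyDense.mono {E E' : Set ℝ} (hE : RelativelyDense E) (h : E ⊆ E') :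
    RelativelyDense E' := by
  obtain ⟨L, hL, hu⟩ := hE
  exact ⟨L, hL, univ_subset_iff.1 (hu ▸ add_subset_add_right h)⟩

theorem inheritsPeriods_of_mem {X : Type*} [NormedAddCommGroup X] {A : Set (ℝ → X)} {f : ℝ → X}
    (hf : f ∈ A) : InheritsPeriods A f :=
  fun K hK ε hε => ⟨f, hf, K, hK, ε, hε, Subset.rfl⟩

theorem InheritsPeriods.isRecurrent {X : Type*} [NormedAddCommGroup X] {A : Set (ℝ → X)}
    {G : ℝ → X} (hA : ∀ f ∈ A, IsRecurrent f) (hG : InheritsPeriods A G) (hc : Continuous G) :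
    IsRecurrent G := by
  refine ⟨hc, fun K hK ε hε => ?_⟩
  obtain ⟨f, hf, K', hK', ε', hε', h⟩ := hG K hK ε hε
  exact ((hA f hf).2 K' hK' ε' hε').mono h

/-- A set of continuous functions which inherit their periods from a jointly recurrent set is
jointly recurrent. -/
theorem JointlyRecurrent.of_inheritsPeriods {X : Type*} [NormedAddCommGroup X]
    {A U : Set (ℝ → X)} (hA : JointlyRecurrent A) (hc : ∀ f ∈ U, Continuous f)
    (hU : ∀ f ∈ U, InheritsPeriods A f) : JointlyRecurrent U := by
  intro n hn f hf
  have : Nonempty (Fin n) := ⟨⟨0, hn⟩⟩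
  refine ⟨continuous_pi fun i => hc _ (hf i), fun K hK ε hε => ?_⟩
  choose g hg K' hK' ε' hε' hsub using fun i => hU _ (hf i) K hK ε hε
  refine ((hA n hn g hg).2 (⋃ i, K' i) (isCompact_iUnion hK')
    (Finset.univ.inf' Finset.univ_nonempty ε') ?_).mono fun τ hτ t ht => ?_
  · exact (Finset.lt_inf'_iff _).2 fun i _ => hε' i
  · refine (pi_norm_le_iff_of_nonneg hε.le).2 fun i => hsub i (fun s hs => ?_) t ht
    exact (norm_le_pi_norm _ i).trans ((hτ s (mem_iUnion.2 ⟨i, hs⟩)).trans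
      (Finset.inf'_le _ (Finset.mem_univ i)))

/-- By maximality, `rec_xy V` contains every function of `REC_xy` that inherits its periods from
`rec_xy V`. -/
theorem IsRec.mem_of_inheritsPeriods {X : Type*} [NormedAddCommGroup X] {R V A : Set (ℝ → X)}
    (hR : ∀ f ∈ R, Continuous f) (hA : IsRec R V A) {G : ℝ → X} (hG : G ∈ R)
    (h : InheritsPeriods A G) : G ∈ A := by
  have hins : insert G A ⊆ R := insert_subset hG hA.prop.1
  refine hA.le_of_ge ⟨hins, hA.prop.2.1.trans (subset_insert G A),
    hA.prop.2.2.of_inheritsPeriods (fun f hf => hR f (hins hf)) ?_⟩ (subset_insert G A)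
    (mem_insert G A)
  rintro f (rfl | hf)
  · exact h
  · exact inheritsPeriods_of_mem hf

/-- A function uniformly close to constants minus averages of its differences `Δ_{jd} F`, with `d`
depending on the quality of approximation, inherits its periods from its differences: each
`Δ_{jd} F` is a sum of translates of the single function `Δ_d F`. Joint recurrence of different
`Δ_h F` is therefore not needed. -/
theorem inheritsPeriods_of_fwdDiff {X : Type*} [NormedAddCommGroup X] [NormedSpace ℝ X]
    {A : Set (ℝ → X)} {F : ℝ → X}
    (happrox : ∀ ε : ℝ, 0 < ε → ∃ m : X, ∃ N : ℕ, 0 < N ∧ ∃ d : ℝ, 0 < d ∧ ∀ x,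
      ‖F x - (m - (N : ℝ)⁻¹ • ∑ j ∈ Finset.range N, fwdDiff ((j + 1) * d) F x)‖ ≤ ε)
    (hd : ∀ h : ℝ, 0 < h → fwdDiff h F ∈ A) : InheritsPeriods A F := by
  intro K hK ε hε
  obtain ⟨m, N, hN, d, hd0, H⟩ := happrox (ε / 4) (by positivity)
  have hN0 : (0 : ℝ) < N := by exact_mod_cast hN
  refine ⟨fwdDiff d F, hd d hd0, K + Icc 0 (N * d), hK.add isCompact_Icc, ε / (2 * N),
    by positivity, fun τ hτ t ht => ?_⟩
  -- An almost period of `Δ_d F` is one of `Δ_{jd} F`, with `j` times the error.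
  have key : ∀ j : ℕ, j ≤ N →
      ‖fwdDiff (j * d) F (t + τ) - fwdDiff (j * d) F t‖ ≤ j * (ε / (2 * N)) := by
    intro j
    induction j with
    | zero => simp [fwdDiff]
    | succ j ih =>
      intro hj
      have h1 := ih (by omega)
      have hjN : (j : ℝ) ≤ N := by exact_mod_cast (show j ≤ N by omega)
      have h2 := hτ (t + j * d) (add_mem_add ht ⟨by positivity, by gcongr⟩)
      have h3 : fwdDiff ((j + 1 : ℕ) * d) F (t + τ) - fwdDiff ((j + 1 : ℕ) * d) F t =
          (fwdDiff (j * d) F (t + τ) - fwdDiff (j * d) F t) +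
          (fwdDiff d F (t + j * d + τ) - fwdDiff d F (t + j * d)) := by
        simp only [fwdDiff]
        rw [show t + j * d + τ + d = t + τ + (j + 1 : ℕ) * d by push_cast; ring,
          show t + j * d + τ = t + τ + j * d by ring,
          show t + j * d + d = t + (j + 1 : ℕ) * d by push_cast; ring]
        abel
      rw [h3]
      refine (norm_add_le _ _).trans ?_
      push_cast
      linarith
  set g : ℝ → X := fun x => (N : ℝ)⁻¹ • ∑ j ∈ Finset.range N, fwdDiff ((j + 1) * d) F x with hg
  have h4 : ‖g (t + τ) - g t‖ ≤ ε / 2 := by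
    rw [hg]
    simp only
    rw [← smul_sub, ← Finset.sum_sub_distrib, norm_smul, norm_inv, Real.norm_of_nonneg hN0.le,
      inv_mul_le_iff₀ hN0]
    have h5 : ∀ j ∈ Finset.range N, ‖fwdDiff ((j + 1) * d) F (t + τ) -
        fwdDiff ((j + 1) * d) F t‖ ≤ ε / 2 := by
      intro j hj
      have hj' : j + 1 ≤ N := Finset.mem_range.1 hj
      have h6 := key (j + 1) hj'
      have hjN : ((j + 1 : ℕ) : ℝ) ≤ N := by exact_mod_cast hj'
      have h7 : ((j + 1 : ℕ) : ℝ) * (ε / (2 * N)) ≤ N * (ε / (2 * N)) := by gcongr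
      rw [show (N : ℝ) * (ε / (2 * N)) = ε / 2 by field_simp] at h7
      push_cast at h6 h7
      exact h6.trans h7
    refine (norm_sum_le_of_le _ h5).trans ?_
    rw [Finset.sum_const, Finset.card_range, nsmul_eq_mul]
  have h8 : F (t + τ) - F t = (F (t + τ) - (m - g (t + τ))) - (F t - (m - g t)) -
      (g (t + τ) - g t) := by abel
  rw [h8]
  have h9 := norm_sub_le (F (t + τ) - (m - g (t + τ))) (F t - (m - g t))
  refine (norm_sub_le _ _).trans ?_
  have h10 : ‖F (t + τ) - (m - g (t + τ))‖ ≤ ε / 4 := H (t + τ)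
  have h11 : ‖F t - (m - g t)‖ ≤ ε / 4 := H t
  linarith

/-- A uniformly continuous ergodic function is uniformly close to a constant minus an average of
its differences. -/
theorem exists_norm_sub_average_fwdDiff_le {X : Type*} [NormedAddCommGroup X] [NormedSpace ℝ X]
    [CompleteSpace X] {F : ℝ → X} (hF : F ∈ ergodicFunctions X) (hu : UniformContinuous F)
    {ε : ℝ} (hε : 0 < ε) : ∃ m : X, ∃ N : ℕ, 0 < N ∧ ∃ d : ℝ, 0 < d ∧ ∀ x,
      ‖F x - (m - (N : ℝ)⁻¹ • ∑ j ∈ Finset.range N, fwdDiff ((j + 1) * d) F x)‖ ≤ ε := by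
  obtain ⟨-, m, hm⟩ := hF
  obtain ⟨S, hS, havg⟩ := exists_norm_average_sub_le hm (show 0 < ε / 2 by positivity)
  obtain ⟨N, hN, H⟩ := exists_norm_integral_sub_riemannSum_le hu hS
    (show 0 < S * (ε / 2) by positivity)
  have hN0 : (0 : ℝ) < N := by exact_mod_cast hN
  refine ⟨m, N, hN, S / N, by positivity, fun x => ?_⟩
  have h1 : ‖S⁻¹ • ((∫ t in (0 : ℝ)..S, F (x + t)) -
      (S / N) • ∑ j ∈ Finset.range N, F (x + (j + 1) * (S / N)))‖ ≤ ε / 2 := by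
    rw [norm_smul, norm_inv, Real.norm_of_nonneg hS.le, inv_mul_le_iff₀ hS]
    exact H x
  have h2 : F x - (m - (N : ℝ)⁻¹ • ∑ j ∈ Finset.range N, fwdDiff ((j + 1) * (S / N)) F x) =
      (S⁻¹ • (∫ t in (0 : ℝ)..S, F (x + t)) - m) -
      S⁻¹ • ((∫ t in (0 : ℝ)..S, F (x + t)) -
      (S / N) • ∑ j ∈ Finset.range N, F (x + (j + 1) * (S / N))) := by
    simp only [fwdDiff, Finset.sum_sub_distrib, Finset.sum_const, Finset.card_range, smul_sub,
      smul_smul]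
    rw [← Nat.cast_smul_eq_nsmul ℝ N, smul_smul, inv_mul_cancel₀ hN0.ne', one_smul,
      show S⁻¹ * (S / N) = (N : ℝ)⁻¹ by field_simp]
    abel
  rw [h2]
  refine (norm_sub_le _ _).trans ?_
  linarith [havg x]

/-! ### Relatively compact ranges -/

theorem isCompact_closure_range_of_approx {X : Type*} [NormedAddCommGroup X] [CompleteSpace X]
    {G : ℝ → X} (h : ∀ ε : ℝ, 0 < ε → ∃ g : ℝ → X, IsCompact (closure (range g)) ∧
      ∀ x, ‖G x - g x‖ ≤ ε) : IsCompact (closure (range G)) := by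
  refine (TotallyBounded.closure ?_).isCompact_of_isClosed isClosed_closure
  rw [Metric.totallyBounded_iff]
  intro ε hε
  obtain ⟨g, hg, hGg⟩ := h (ε / 2) (by positivity)
  obtain ⟨t, ht, hsub⟩ := Metric.totallyBounded_iff.1 hg.totallyBounded (ε / 2) (by positivity)
  refine ⟨t, ht, ?_⟩
  rintro _ ⟨x, rfl⟩
  obtain ⟨y, hy, hxy⟩ := mem_iUnion₂.1 (hsub (subset_closure (mem_range_self x)))
  refine mem_iUnion₂.2 ⟨y, hy, ?_⟩
  rw [Metric.mem_ball] at hxy ⊢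
  have h1 := dist_triangle (G x) (g x) y
  rw [dist_eq_norm (G x) (g x)] at h1
  linarith [hGg x]

theorem isCompact_closure_range_sum {X : Type*} [NormedAddCommGroup X] {f : ℕ → ℝ → X} {N : ℕ}
    (hf : ∀ j < N, IsCompact (closure (range (f j)))) :
    IsCompact (closure (range fun x => ∑ j ∈ Finset.range N, f j x)) := by
  induction N with
  | zero => simp
  | succ N ih =>
    refine ((ih fun j hj => hf j (by omega)).add (hf N (by omega))).closure_of_subset ?_
    rintro _ ⟨x, rfl⟩
    simp only [Finset.sum_range_succ]
    exact add_mem_add (subset_closure (mem_range_self x)) (subset_closure (mem_range_self x))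

theorem isCompact_closure_range_comp {X : Type*} [NormedAddCommGroup X] {f : ℝ → X} {φ : X → X}
    (hf : IsCompact (closure (range f))) (hφ : Continuous φ) :
    IsCompact (closure (range fun x => φ (f x))) := by
  refine (hf.image hφ).closure_of_subset ?_
  rintro _ ⟨x, rfl⟩
  exact mem_image_of_mem φ (subset_closure (mem_range_self x))

/-! ### The differences of an indefinite integral -/

theorem fwdDiff_indefIntegral {X : Type*} [NormedAddCommGroup X] [NormedSpace ℝ X] {f : ℝ → X}
    (hf : Continuous f) (h x : ℝ) :
    fwdDiff h (indefIntegral f) x = ∫ t in (0 : ℝ)..h, f (x + t) := by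
  have h1 := intervalIntegral.integral_comp_add_left (a := 0) (b := h) f x
  rw [h1, add_zero, fwdDiff, indefIntegral, indefIntegral,
    intervalIntegral.integral_interval_sub_left (hf.intervalIntegrable _ _)
    (hf.intervalIntegrable _ _)]

/-- The increment of `Δ_h Pf` between two points is controlled by that of `f`. -/
theorem norm_fwdDiff_indefIntegral_sub_le {X : Type*} [NormedAddCommGroup X] [NormedSpace ℝ X]
    {f : ℝ → X} (hf : Continuous f) {h : ℝ} (hh : 0 < h) {x y C : ℝ}
    (hC : ∀ t ∈ Icc 0 h, ‖f (x + t) - f (y + t)‖ ≤ C) :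
    ‖fwdDiff h (indefIntegral f) x - fwdDiff h (indefIntegral f) y‖ ≤ C * h := by
  have hint : ∀ x : ℝ, IntervalIntegrable (fun t => f (x + t)) volume 0 h := fun x =>
    (hf.comp (continuous_const.add continuous_id)).intervalIntegrable 0 h
  rw [fwdDiff_indefIntegral hf, fwdDiff_indefIntegral hf,
    ← intervalIntegral.integral_sub (hint x) (hint y)]
  have h1 := intervalIntegral.norm_integral_le_of_norm_le_const (C := C) (a := 0) (b := h)
    (f := fun t => f (x + t) - f (y + t)) ?_
  · rwa [sub_zero, abs_of_pos hh] at h1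
  · intro t ht
    rw [uIoc_of_le hh.le] at ht
    exact hC t ⟨ht.1.le, ht.2⟩

theorem uniformContinuous_fwdDiff_indefIntegral {X : Type*} [NormedAddCommGroup X]
    [NormedSpace ℝ X] {f : ℝ → X} (hf : UniformContinuous f) {h : ℝ} (hh : 0 < h) :
    UniformContinuous (fwdDiff h (indefIntegral f)) := by
  rw [Metric.uniformContinuous_iff_le]
  intro ε hε
  obtain ⟨δ, hδ, H⟩ := Metric.uniformContinuous_iff_le.1 hf (ε / h) (by positivity)
  refine ⟨δ, hδ, fun {a b} hab => ?_⟩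
  rw [dist_eq_norm]
  have h1 := norm_fwdDiff_indefIntegral_sub_le hf.continuous hh (x := a) (y := b) (C := ε / h)
    fun t _ => by
      rw [← dist_eq_norm]
      exact H (by simpa using hab)
  rwa [div_mul_cancel₀ _ hh.ne'] at h1

theorem inheritsPeriods_fwdDiff_indefIntegral {X : Type*} [NormedAddCommGroup X]
    [NormedSpace ℝ X] {A : Set (ℝ → X)} {f : ℝ → X} (hfA : f ∈ A) (hf : Continuous f) {h : ℝ}
    (hh : 0 < h) : InheritsPeriods A (fwdDiff h (indefIntegral f)) := by
  intro K hK ε hε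
  refine ⟨f, hfA, K + Icc 0 h, hK.add isCompact_Icc, ε / h, by positivity, fun τ hτ t ht => ?_⟩
  have h1 := norm_fwdDiff_indefIntegral_sub_le hf hh (x := t + τ) (y := t) (C := ε / h)
    fun s hs => by
      rw [add_right_comm]
      exact hτ (t + s) (add_mem_add ht hs)
  rwa [div_mul_cancel₀ _ hh.ne'] at h1

theorem isCompact_closure_range_fwdDiff_indefIntegral {X : Type*} [NormedAddCommGroup X]
    [NormedSpace ℝ X] [CompleteSpace X] {f : ℝ → X} (hf : UniformContinuous f)
    (hfc : IsCompact (closure (range f))) {h : ℝ} (hh : 0 < h) :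
    IsCompact (closure (range (fwdDiff h (indefIntegral f)))) := by
  refine isCompact_closure_range_of_approx fun ε hε => ?_
  obtain ⟨N, -, H⟩ := exists_norm_integral_sub_riemannSum_le hf hh hε
  refine ⟨_, ?_, fun x => (fwdDiff_indefIntegral hf.continuous h x).symm ▸ H x⟩
  refine isCompact_closure_range_comp (φ := fun v => (h / N : ℝ) • v)
    (isCompact_closure_range_sum fun j _ => ?_) (continuous_const_smul _)
  refine hfc.closure_of_subset ?_
  rintro _ ⟨x, rfl⟩
  exact subset_closure (mem_range_self _)

/-! ### The two properties -/

/-- `(L)` and `(P)` hold for every subset of `REC_xy` that contains each function of `REC_xy`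
inheriting its periods from it. -/
theorem satisfiesL_and_satisfiesP_of_inheritsPeriods {X : Type*} [NormedAddCommGroup X]
    [NormedSpace ℝ X] [CompleteSpace X] {R A : Set (ℝ → X)} (hR : R = RECu X ∨ R = RECurc X)
    (hAR : A ⊆ R) (hA : ∀ G ∈ R, InheritsPeriods A G → G ∈ A) :
    SatisfiesL A (ergodicFunctions X) ∧ SatisfiesP A (ergodicFunctions X) := by
  have hRu : R ⊆ RECu X := by
    rcases hR with rfl | rfl
    · exact Subset.rfl
    · exact RECurc_subset_RECu X
  have hAr : ∀ f ∈ A, IsRecurrent f := fun f hf => (hRu (hAR hf)).1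
  have hL : SatisfiesL A (ergodicFunctions X) := by
    intro F hF hd
    have hu := uniformContinuous_of_fwdDiff hF fun h hh => hRu (hAR (hd h hh))
    have happ := fun ε (hε : 0 < ε) => exists_norm_sub_average_fwdDiff_le hF hu hε
    have hi := inheritsPeriods_of_fwdDiff happ hd
    have hrec := hi.isRecurrent hAr hu.continuous
    refine hA F ?_ hi
    rcases hR with rfl | rfl
    · exact ⟨hrec, hu⟩
    · refine ⟨hrec, hu, isCompact_closure_range_of_approx fun ε hε => ?_⟩
      obtain ⟨m, N, -, d, hd0, H⟩ := happ ε hε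
      exact ⟨_, isCompact_closure_range_comp (φ := fun v => m - (N : ℝ)⁻¹ • v)
        (isCompact_closure_range_sum fun j _ => (hAR (hd ((j + 1) * d) (by positivity))).2.2)
        (by fun_prop), H⟩
  refine ⟨hL, fun f hf hPf => hL _ hPf fun h hh => ?_⟩
  have hfu := (hRu (hAR hf)).2
  have hi := inheritsPeriods_fwdDiff_indefIntegral hf hfu.continuous hh
  have hu := uniformContinuous_fwdDiff_indefIntegral hfu hh
  have hrec := hi.isRecurrent hAr hu.continuous
  refine hA _ ?_ hi
  rcases hR with rfl | rfl
  · exact ⟨hrec, hu⟩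
  · exact ⟨hrec, hu, isCompact_closure_range_fwdDiff_indefIntegral hfu (hAR hf).2.2 hh⟩

theorem proposition4p2 {X : Type*} [NormedAddCommGroup X] [NormedSpace ℝ X] [CompleteSpace X]
    (R : Set (ℝ → X)) (hR : R = RECu X ∨ R = RECurc X) :
    (∀ V : Set (ℝ → X), V.Nonempty → V ⊆ R → JointlyRecurrent V →
      ∀ A : Set (ℝ → X), IsRec R V A →
        SatisfiesL A (ergodicFunctions X) ∧ SatisfiesP A (ergodicFunctions X)) ∧
    SatisfiesL R (ergodicFunctions X) ∧ SatisfiesP R (ergodicFunctions X) := by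
  refine ⟨fun V _ _ _ A hA => ?_,
    satisfiesL_and_satisfiesP_of_inheritsPeriods hR Subset.rfl fun G hG _ => hG⟩
  refine satisfiesL_and_satisfiesP_of_inheritsPeriods hR hA.prop.1 fun G hG hi =>
    hA.mem_of_inheritsPeriods (fun f hf => ?_) hG hi
  rcases hR with rfl | rfl
  · exact hf.2.continuous
  · exact hf.2.1.continuous
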